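/- **Theorem 4.2.** Let $d\ge 0$ and identify a pair $(\mathbf m,\Sigma)$, with $\mathbf m\in\mathbb R^d$ and $\Sigma$ a real symmetric $d\times d$ matrix, with a point $(\mathbf m,\boldsymbol\sigma)$ of $\mathbb R^{d}\times\mathbb R^{d(d+1)/2}=\mathbb{R}^{d'}$, where $\boldsymbol\sigma$ lists the entries $\Sigma_{ij}$, $i\le j$. Let $$S=\{(\mathbf m,\boldsymbol\sigma)\in\mathbb R^{d'}:\ g_j(\mathbf m,\boldsymbol\sigma)\ge 0,\ j=1,\dots,s\}$$ for polynomials $g_1,\dots,g_s\in\mathbb R[\mathbf m,\boldsymbol\sigma]$. Assume that $\Sigma$ is positive semidefinite for every $(\mathbf m,\Sigma)\in S$, that $S$ is compact with nonempty interior, and that the quadratic module $Q=\{\theta_0+\sum_{j=1}^s\theta_j g_j:\ \theta_0,\dots,\theta_s \text{ sums of squares in }\mathbb R[\mathbf m,\boldsymbol\sigma]\}$ is Archimedean, i.e. $R-\Vert\mathbf m\Vert^2-\Vert\boldsymbol\sigma\Vert^2\in Q$ for some $R\in\mathbb R$. Let $\mu$ be a Borel probability measure on $\mathbb R^d$ such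 that for some $c>0$, $\int \exp(c|x_i|)\,d\mu<\infty$ for all $i=1,\dots,d$. Write $\mathscr P(X)$ for the Borel probability measures on $X$. For $\phi\in\mathscr P(S)$ let $\nu_\phi(B)=\int_S\mathcal N(\mathbf m,\Sigma)(B)\,d\phi(\mathbf m,\Sigma)$ be the Gaussian mixture with mixing measure $\phi$, where $\mathcal N(\mathbf m,\Sigma)$ is the (possibly degenerate) Gaussian measure with mean $\mathbf m$ and covariance matrix $\Sigma$. Let $p_{\boldsymbol\alpha}(\mathbf m,\boldsymbol\sigma)=\int\mathbf x^{\boldsymbol\alpha}\,d\mathcal N(\mathbf m,\Sigma)$ for $\boldsymbol\alpha\in\mathbb N^d$. For $\lambda\in\mathscr P(\mathbb R^d\times\mathbb R^d)$ let $\lambda_{\mathbf x},\lambda_{\mathbf y}$ be its marginals. For probability measures $\mu,\nu$ on $\mathbb R^d$ let $W_2(\mu,\nu)^2=\inf\{\int\Vert\mathbf x-\mathbf y\Vert^2d\lambda:\ \lambda_{\mathbf x}=\mu,\ \lambda_{\mathbf y}=\nu\}$. Consider the problem $$\tau=\inf_{\phi\in\mathscr P(S)}W_2(\mu,\nu_\phi)^2=\inf_{\phi\in\mathscr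 P(S),\,\lambda\in\mathscr P(\mathbb R^{2d})}\Big\{\int\Vert\mathbf x-\mathbf y\Vert^2d\lambda:\ \lambda_{\mathbf x}=\mu,\ \lambda_{\mathbf y}=\nu_\phi\Big\}\tag{OT}$$ and its moment formulation $$\inf_{\phi\in\mathscr P(S),\,\lambda\in\mathscr P(\mathbb R^{2d})}\Big\{\int\Vert\mathbf x-\mathbf y\Vert^2d\lambda:\ \int\mathbf x^{\boldsymbol\alpha}d\lambda=\int\mathbf x^{\boldsymbol\alpha}d\mu,\ \ \int\mathbf y^{\boldsymbol\alpha}d\lambda=\int_S p_{\boldsymbol\alpha}\,d\phi\ \ \forall\boldsymbol\alpha\in\mathbb N^d\Big\},\tag{M}$$ where the feasible $\lambda$ of (M) are required to have all the moments $\int\mathbf x^{\boldsymbol\alpha}d\lambda$, $\int\mathbf y^{\boldsymbol\alpha}d\lambda$ finite (absolutely convergent). A Borel measure is moment determinate if all its moments are finite and no other Borel measure has the same moments. Then: (i) Problem (OT) has an optimal solution $(\phi^*,\lambda^*)\in\mathscr P(S)\times\mathscr P(\mathbb R^{2d})$ that is also an optimal solution of (M); it satisfies $\tau=W_2(\mu,\nu_{\phi^*})^2=\int\Vert\mathbf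 x-\mathbf y\Vert^2d\lambda^*$, and both $\lambda^*$ and $\nu_{\phi^*}$ are moment determinate. (ii) For every optimal solution $(\phi^*,\lambda^*)$ of (OT), $\tau=0$ if and only if $\mu=\nu_{\phi^*}$ and $\lambda^*$ is the diagonal coupling of $\mu$ with itself, i.e. the image of $\mu$ under $\mathbf x\mapsto(\mathbf x,\mathbf x)$. Moreover, $\tau=0$ if and only if $\mu=\nu_\phi$ for some $\phi\in\mathscr P(S)$, i.e. $\mu$ is a Gaussian mixture with parameters in $S$. -/

import Mathlib

open MeasureTheory ProbabilityTheory
open scoped ENNReal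

noncomputable section

namespace GaussianMixtureOT

/-! ### Gaussian parameters -/

/-- The space `ℝ^d`. -/
abbrev Space (d : ℕ) : Type := EuclideanSpace ℝ (Fin d)

/-- Index set of the `d + d(d+1)/2` real parameters of a Gaussian measure on `ℝ^d`: the `d`
coordinates of the mean, and one entry for every unordered pair `{i, j}`, `i, j ∈ Fin d`. -/
abbrev ParamIndex (d : ℕ) : Type := Fin d ⊕ Sym2 (Fin d)

/-- The parameter space `ℝ^d × ℝ^{d(d+1)/2}` of pairs `(m, σ)`. -/
abbrev Param (d : ℕ) : Type := ParamIndex d → ℝ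

/-- The mean `m` of the parameter `(m, σ)`. -/
def Param.mean {d : ℕ} (θ : Param d) : Space d :=
  WithLp.toLp 2 fun i => θ (Sum.inl i)

/-- The symmetric matrix `Σ` of the parameter `(m, σ)`, with entries `Σ i j = σ {i, j}`. -/
def Param.cov {d : ℕ} (θ : Param d) : Matrix (Fin d) (Fin d) ℝ :=
  Matrix.of fun i j => θ (Sum.inr s(i, j))

/-- The Gaussian measure `N(m, Σ)` on `ℝ^d`. -/
def gaussian {d : ℕ} (θ : Param d) : Measure (Space d) :=
  multivariateGaussian θ.mean θ.cov

/-- The Gaussian mixture `ν_φ(B) = ∫_S N(m, Σ)(B) dφ(m, Σ)` with mixing measure `φ` on `S`. -/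
def mixture {d : ℕ} {S : Set (Param d)} (φ : ProbabilityMeasure S) : Measure (Space d) :=
  (φ : Measure S).bind fun θ => gaussian (θ : Param d)

open scoped MatrixOrder Matrix.Norms.L2Operator in
/-- The Gaussian measure depends measurably on its parameters where `Σ` is positive semidefinite. -/
theorem measurable_gaussian {d : ℕ} {S : Set (Param d)} (h : ∀ θ ∈ S, θ.cov.PosSemidef) :
    Measurable fun θ : S => gaussian (θ : Param d) := by
  have hs : Continuous fun θ : S => CFC.sqrt (θ : Param d).cov := by
    have hc : Continuous fun θ : S => (θ : Param d).cov :=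
      continuous_matrix fun i j => (continuous_apply (Sum.inr s(i, j) : ParamIndex d)).comp continuous_subtype_val
    exact CFC.continuousOn_sqrt.comp_continuous hc fun θ => (h θ θ.2).nonneg
  have hj : Continuous fun p : S × Space d => (p.1 : Param d).mean +
      Matrix.toEuclideanCLM (𝕜 := ℝ) (n := Fin d) (CFC.sqrt (p.1 : Param d).cov) p.2 := by
    refine Continuous.add ?_ ?_
    · exact (PiLp.continuous_toLp 2 _).comp (continuous_pi fun i =>
        (continuous_apply (Sum.inl i : ParamIndex d)).comp
          (continuous_subtype_val.comp continuous_fst))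
    · have : Continuous fun p : S × Space d =>
          (WithLp.toLp 2 ((CFC.sqrt (p.1 : Param d).cov).mulVec p.2.ofLp) : Space d) :=
        (PiLp.continuous_toLp 2 _).comp
          (Continuous.matrix_mulVec (hs.comp continuous_fst) (by fun_prop))
      exact this
  refine Measure.measurable_of_measurable_coe _ fun B hB => ?_
  have := measurable_measure_prodMk_left (ν := stdGaussian (Space d)) (hj.measurable hB)
  convert this using 2 with θ
  rw [gaussian, multivariateGaussian, Measure.map_apply (by fun_prop) hB]
  rfl

/-- The defining formula `ν_φ(B) = ∫_S N(m, Σ)(B) dφ(m, Σ)` of a mixture. -/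
theorem mixture_apply {d : ℕ} {S : Set (Param d)} (h : ∀ θ ∈ S, θ.cov.PosSemidef)
    (φ : ProbabilityMeasure S) {B : Set (Space d)} (hB : MeasurableSet B) :
    mixture φ B = ∫⁻ θ, gaussian (θ : Param d) B ∂(φ : Measure S) :=
  Measure.bind_apply hB (measurable_gaussian h).aemeasurable

/-! ### Basic semi-algebraic sets and quadratic modules -/

/-- The basic semi-algebraic set `{x | g j x ≥ 0 for all j}`. -/
def semialgebraicSet {ι : Type*} {s : ℕ} (g : Fin s → MvPolynomial ι ℝ) : Set (ι → ℝ) :=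
  {x | ∀ j, 0 ≤ MvPolynomial.eval x (g j)}

/-- The quadratic module generated by `g`: the polynomials `θ₀ + ∑ j, θ j * g j` with `θ₀` and
all the `θ j` sums of squares of polynomials. -/
def quadraticModule {ι : Type*} {s : ℕ} (g : Fin s → MvPolynomial ι ℝ) :
    Set (MvPolynomial ι ℝ) :=
  {p | ∃ (θ₀ : MvPolynomial ι ℝ) (θ : Fin s → MvPolynomial ι ℝ),
    IsSumSq θ₀ ∧ (∀ j, IsSumSq (θ j)) ∧ p = θ₀ + ∑ j, θ j * g j}

/-- The quadratic module generated by `g` is Archimedean: it contains `R - ∑ i, X i ^ 2` for some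
real number `R`. -/
def IsArchimedean {ι : Type*} [Fintype ι] {s : ℕ} (g : Fin s → MvPolynomial ι ℝ) : Prop :=
  ∃ R : ℝ, MvPolynomial.C R - ∑ i, MvPolynomial.X i ^ 2 ∈ quadraticModule g

/-! ### Moments -/

/-- The monomial `x^α = ∏ i, x i ^ α i`. -/
def monomial {ι : Type*} [Fintype ι] (α : ι → ℕ) (x : ι → ℝ) : ℝ :=
  ∏ i, x i ^ α i

/-- The coordinates of a point of `ℝ^d × ℝ^d = ℝ^{2d}`. -/
def pairCoord {d : ℕ} (z : Space d × Space d) : Fin d ⊕ Fin d → ℝ :=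
  Sum.elim z.1 z.2

/-- A measure on a space with coordinates `c : E → ℝ^ι` is moment determinate if all its moments
are finite and no other measure has the same moments. -/
def IsMomentDeterminate {E ι : Type*} [MeasurableSpace E] [Fintype ι] (c : E → ι → ℝ)
    (μ : Measure E) : Prop :=
  (∀ α : ι → ℕ, Integrable (fun x => monomial α (c x)) μ) ∧
  ∀ ν : Measure E,
    (∀ α : ι → ℕ, Integrable (fun x => monomial α (c x)) ν ∧
      ∫ x, monomial α (c x) ∂ν = ∫ x, monomial α (c x) ∂μ) → ν = μ

/-- The moment `p_α(m, σ) = ∫ x^α dN(m, Σ)` as a function of the parameters. -/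
def gaussianMoment {d : ℕ} (α : Fin d → ℕ) (θ : Param d) : ℝ :=
  ∫ x, monomial α x ∂(gaussian θ)

/-! ### The optimization problems -/

/-- The transport cost `∫ ‖x - y‖² dλ(x, y)`. -/
def cost {d : ℕ} (lam : Measure (Space d × Space d)) : ℝ≥0∞ :=
  ∫⁻ z, ‖z.1 - z.2‖ₑ ^ 2 ∂lam

/-- The squared Wasserstein distance `W₂(μ, ν)²`, an infimum over the couplings of `μ`, `ν`. -/
def wassersteinSq {d : ℕ} (μ ν : Measure (Space d)) : ℝ≥0∞ :=
  ⨅ (lam : ProbabilityMeasure (Space d × Space d))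
    (_ : (lam : Measure (Space d × Space d)).map Prod.fst = μ ∧
      (lam : Measure (Space d × Space d)).map Prod.snd = ν),
    cost (lam : Measure (Space d × Space d))

/-- The optimal value `τ = inf_{φ ∈ P(S)} W₂(μ, ν_φ)²`. -/
def optValue {d : ℕ} (μ : Measure (Space d)) (S : Set (Param d)) : ℝ≥0∞ :=
  ⨅ φ : ProbabilityMeasure S, wassersteinSq μ (mixture φ)

/-- Feasible pairs `(φ, λ)` of the transport problem: the marginals of `λ` are `μ` and `ν_φ`. -/
def transportFeasible {d : ℕ} (μ : Measure (Space d)) (S : Set (Param d)) :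
    Set (ProbabilityMeasure S × ProbabilityMeasure (Space d × Space d)) :=
  {p | (p.2 : Measure (Space d × Space d)).map Prod.fst = μ ∧
    (p.2 : Measure (Space d × Space d)).map Prod.snd = mixture p.1}

/-- Feasible pairs `(φ, λ)` of the moment formulation: all the moments of the marginals of `λ`
exist, `∫ x^α dλ = ∫ x^α dμ` and `∫ y^α dλ = ∫ p_α dφ` for every `α`. -/
def momentFeasible {d : ℕ} (μ : Measure (Space d)) (S : Set (Param d)) :
    Set (ProbabilityMeasure S × ProbabilityMeasure (Space d × Space d)) :=
  {p | ∀ α : Fin d → ℕ,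
    (Integrable (fun z : Space d × Space d => monomial α z.1)
        (p.2 : Measure (Space d × Space d)) ∧
      ∫ z, monomial α z.1 ∂(p.2 : Measure (Space d × Space d)) = ∫ x, monomial α x ∂μ) ∧
    (Integrable (fun z : Space d × Space d => monomial α z.2)
        (p.2 : Measure (Space d × Space d)) ∧
      ∫ z, monomial α z.2 ∂(p.2 : Measure (Space d × Space d)) =
        ∫ θ, gaussianMoment α (θ : Param d) ∂(p.1 : Measure S))}

/-- `p = (φ, λ)` is an optimal solution of: minimize `∫ ‖x - y‖² dλ` over the pairs in `F`. -/
def IsOptimal {d : ℕ} {S : Set (Param d)}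
    (F : Set (ProbabilityMeasure S × ProbabilityMeasure (Space d × Space d)))
    (p : ProbabilityMeasure S × ProbabilityMeasure (Space d × Space d)) : Prop :=
  p ∈ F ∧ ∀ q ∈ F,
    cost (p.2 : Measure (Space d × Space d)) ≤ cost (q.2 : Measure (Space d × Space d))

end GaussianMixtureOT

end

noncomputable section

namespace GaussianMixtureOT

/-! ### Moment determinacy of measures with exponential moments -/

/-! Two facts carry the theorem. The first is that the moment constraints are marginal constraints
in disguise. Exponential moments of the coordinates force moment determinacy (`eq_of_moments_eq`): a
measure with the same moments inherits the exponential moments, since `cosh` is a series of even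
powers with nonnegative terms; hence, for every linear functional, both complex moment generating
functions are analytic on a vertical strip around the imaginary axis. Their Taylor coefficients at
`0` are the moments, so they agree on the strip, and in particular the characteristic functions
agree. This applies to `μ` by assumption, to each mixture because the parameters lie in a compact
set (`integrable_exp_abs_mixture`), and to every coupling of the two. So (OT) and (M) have the same
feasible pairs (`momentFeasible_eq_transportFeasible`). The second is the direct method. `φ ↦ ν_φ`
is weakly continuous because `N(m, Σ)` is the image of the standard Gaussian under `x ↦ m + √Σ x`,
and `√` is continuous on positive semidefinite matrices. With Prokhorov's theorem the feasible set
is weakly compact (`isCompact_transportFeasible`). The cost is weakly lower semicontinuous, so a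
minimizer exists. Finally, zero cost means concentration on the diagonal, which makes the two
marginals equal. -/

/-- Two real random variables with finite exponential moments near `0` and with the same moments
have the same complex moment generating function on the imaginary axis. -/
theorem complexMGF_I_eq_of_moments {Ω Ω' : Type*} {mΩ : MeasurableSpace Ω}
    {mΩ' : MeasurableSpace Ω'} {P : Measure Ω} {P' : Measure Ω'} {X : Ω → ℝ} {Y : Ω' → ℝ}
    (hX : 0 ∈ interior (integrableExpSet X P)) (hY : 0 ∈ interior (integrableExpSet Y P'))
    (h : ∀ n : ℕ, ∫ ω, X ω ^ n ∂P = ∫ ω, Y ω ^ n ∂P') :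
    complexMGF X P Complex.I = complexMGF Y P' Complex.I := by
  set s : Set ℝ := interior (integrableExpSet X P) ∩ interior (integrableExpSet Y P')
  have hconv : Convex ℝ (Complex.re ⁻¹' s) :=
    (convex_integrableExpSet.interior.inter convex_integrableExpSet.interior).linear_preimage
      Complex.reLm
  have hfX : AnalyticOnNhd ℂ (complexMGF X P) (Complex.re ⁻¹' s) := fun z hz =>
    analyticAt_complexMGF hz.1
  have hfY : AnalyticOnNhd ℂ (complexMGF Y P') (Complex.re ⁻¹' s) := fun z hz =>
    analyticAt_complexMGF hz.2
  have h0 : (0 : ℂ) ∈ Complex.re ⁻¹' s := ⟨by simpa using hX, by simpa using hY⟩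
  have hI : Complex.I ∈ Complex.re ⁻¹' s := ⟨by simpa using hX, by simpa using hY⟩
  -- The `n`-th derivative of a complex mgf at `0` is the `n`-th moment, so the two power series at
  -- `0` coincide.
  have hd : ∀ n : ℕ, iteratedDeriv n (complexMGF X P) 0 = iteratedDeriv n (complexMGF Y P') 0 := by
    intro n
    rw [iteratedDeriv_complexMGF h0.1, iteratedDeriv_complexMGF h0.2]
    have := congrArg (fun r : ℝ => (r : ℂ)) (h n)
    simp only [← integral_complex_ofReal, Complex.ofReal_pow] at this
    simpa using this
  have hev : complexMGF X P =ᶠ[nhds 0] complexMGF Y P' := by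
    have h1 := (hfX 0 h0).hasFPowerSeriesAt
    simp only [hd] at h1
    have := HasFPowerSeriesAt.sub h1 (hfY 0 h0).hasFPowerSeriesAt
    rw [sub_self] at this
    filter_upwards [this.eventually_eq_zero] with z hz
    exact sub_eq_zero.1 hz
  -- Identity theorem on the convex strip, which contains both `0` and `I`.
  exact hfX.eqOn_of_preconnected_of_eventuallyEq hfY hconv.isPreconnected h0 hev hI

/-- Exponential moments of the coordinates give an exponential moment of the norm. -/
theorem integrable_exp_norm {ι : Type*} [Fintype ι] {μ : Measure (ι → ℝ)} [IsFiniteMeasure μ]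
    {c : ℝ} (hc : 0 < c) (h : ∀ i, Integrable (fun x => Real.exp (c * |x i|)) μ) :
    Integrable (fun x => Real.exp (c * ‖x‖)) μ := by
  -- The norm is a maximum of coordinates, so one term of the sum already dominates; the summand `1`
  -- covers the empty index type.
  refine Integrable.mono' (g := fun x => 1 + ∑ i, Real.exp (c * |x i|))
    ((integrable_const _).add (integrable_finsetSum _ fun i _ => h i))
    (by fun_prop) (Filter.Eventually.of_forall fun x => ?_)
  rw [Real.norm_of_nonneg (Real.exp_pos _).le]
  rcases isEmpty_or_nonempty ι with hι | hι
  · simp [Subsingleton.elim x 0]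
  · obtain ⟨i, -, hi⟩ := Finset.exists_max_image Finset.univ (fun i => |x i|) Finset.univ_nonempty
    have hx : ‖x‖ ≤ |x i| := (pi_norm_le_iff_of_nonneg (abs_nonneg _)).2
      fun j => hi j (Finset.mem_univ j)
    calc Real.exp (c * ‖x‖) ≤ Real.exp (c * |x i|) := by gcongr
      _ ≤ ∑ i, Real.exp (c * |x i|) :=
        Finset.single_le_sum (f := fun i => Real.exp (c * |x i|))
          (fun j _ => (Real.exp_pos _).le) (Finset.mem_univ i)
      _ ≤ _ := by linarith

theorem abs_monomial_le {ι : Type*} [Fintype ι] (α : ι → ℕ) (x : ι → ℝ) :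
    |monomial α x| ≤ ‖x‖ ^ ∑ i, α i := by
  rw [monomial, Finset.abs_prod, ← Finset.prod_pow_eq_pow_sum]
  refine Finset.prod_le_prod (fun _ _ => abs_nonneg _) fun i _ => ?_
  rw [abs_pow]
  exact pow_le_pow_left₀ (abs_nonneg _) (norm_le_pi_norm x i) _

theorem measurable_monomial {ι : Type*} [Fintype ι] (α : ι → ℕ) :
    Measurable (monomial α : (ι → ℝ) → ℝ) :=
  Finset.measurable_prod _ fun i _ => (measurable_pi_apply i).pow_const _

theorem integrable_monomial {ι : Type*} [Fintype ι] {μ : Measure (ι → ℝ)} [IsFiniteMeasure μ]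
    {c : ℝ} (hc : 0 < c) (h : ∀ i, Integrable (fun x => Real.exp (c * |x i|)) μ) (α : ι → ℕ) :
    Integrable (monomial α) μ := by
  set N := ∑ i, α i
  -- The constant comes from `u ^ N / N! ≤ exp u` at `u = c * ‖x‖`.
  refine Integrable.mono' (g := fun x => (N.factorial / c ^ N) * Real.exp (c * ‖x‖))
    ((integrable_exp_norm hc h).const_mul _) (measurable_monomial α).aestronglyMeasurable
    (Filter.Eventually.of_forall fun x => (abs_monomial_le α x).trans ?_)
  have := Real.pow_div_factorial_le_exp (c * ‖x‖) (by positivity) N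
  rw [div_le_iff₀ (by positivity), mul_pow] at this
  rw [div_mul_eq_mul_div, le_div_iff₀ (by positivity)]
  linarith

/-- All the linear functionals of a measure with exponential moments have exponential moments. -/
theorem zero_mem_interior_integrableExpSet {ι : Type*} [Fintype ι] {μ : Measure (ι → ℝ)}
    [IsFiniteMeasure μ] {c : ℝ} (hc : 0 < c)
    (h : ∀ i, Integrable (fun x => Real.exp (c * |x i|)) μ) (L : StrongDual ℝ (ι → ℝ)) :
    0 ∈ interior (integrableExpSet L μ) := by
  -- For `|t|` below this radius, `|t| * ‖L‖ ≤ c`; the `+ 1` keeps the quotient meaningful when `L =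
  -- 0`.
  have hpos : 0 < c / (‖L‖ + 1) := by positivity
  refine mem_interior.2 ⟨Metric.ball 0 (c / (‖L‖ + 1)), fun t ht => ?_, Metric.isOpen_ball,
    Metric.mem_ball_self hpos⟩
  rw [mem_ball_zero_iff, Real.norm_eq_abs, lt_div_iff₀ (by positivity)] at ht
  refine (integrable_exp_norm hc h).mono' (by fun_prop) (Filter.Eventually.of_forall fun x => ?_)
  rw [Real.norm_of_nonneg (Real.exp_pos _).le]
  refine Real.exp_le_exp.2 ?_
  calc t * L x ≤ |t| * ‖L x‖ := by
        rw [Real.norm_eq_abs, ← abs_mul]; exact le_abs_self _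
    _ ≤ |t| * (‖L‖ * ‖x‖) := by gcongr; exact L.le_opNorm x
    _ = (|t| * ‖L‖) * ‖x‖ := by ring
    _ ≤ c * ‖x‖ := by
        gcongr
        nlinarith [abs_nonneg t]

/-- The moments of a linear functional are determined by the moments of the measure. -/
theorem integral_strongDual_pow_eq {ι : Type*} [Fintype ι] {μ ν : Measure (ι → ℝ)}
    (hμ : ∀ α : ι → ℕ, Integrable (monomial α) μ) (hν : ∀ α : ι → ℕ, Integrable (monomial α) ν)
    (h : ∀ α : ι → ℕ, ∫ x, monomial α x ∂ν = ∫ x, monomial α x ∂μ)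
    (L : StrongDual ℝ (ι → ℝ)) (n : ℕ) : ∫ x, L x ^ n ∂ν = ∫ x, L x ^ n ∂μ := by
  classical
  have key : ∀ p : MvPolynomial ι ℝ, ∀ x : ι → ℝ,
      MvPolynomial.eval x p = ∑ m ∈ p.support, p.coeff m * monomial m x := fun p x => by
    rw [MvPolynomial.eval_eq']; rfl
  -- A power of a linear form is a polynomial in the coordinates, so its integral is a fixed linear
  -- combination of moments.
  have hL : ∀ x, L x ^ n = MvPolynomial.eval x
      ((∑ i, MvPolynomial.C (L (Pi.single i 1)) * MvPolynomial.X i) ^ n) := fun x => by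
    simp only [map_pow, map_sum, map_mul, MvPolynomial.eval_C, MvPolynomial.eval_X]
    congr 1
    conv_lhs => rw [pi_eq_sum_univ' x]
    simp [mul_comm]
  simp only [hL, key]
  have hsum : ∀ {ρ : Measure (ι → ℝ)}, (∀ α : ι → ℕ, Integrable (monomial α) ρ) →
      ∀ p : MvPolynomial ι ℝ, ∫ x, ∑ m ∈ p.support, p.coeff m * monomial m x ∂ρ =
        ∑ m ∈ p.support, p.coeff m * ∫ x, monomial m x ∂ρ := fun hρ p => by
    rw [integral_finsetSum _ fun (m : ι →₀ ℕ) _ => (hρ m).const_mul (p.coeff m)]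
    simp only [integral_const_mul]
  rw [hsum hν, hsum hμ]
  simp only [h]

/-- All terms of the `cosh` series are nonnegative, so Tonelli applies without any exponential
moment, both sides being possibly infinite. Since the right side sees only moments, finiteness of
the left side passes between variables with the same moments. -/
theorem lintegral_cosh_eq {Ω : Type*} {mΩ : MeasurableSpace Ω} {P : Measure Ω} {X : Ω → ℝ}
    (hX : Measurable X) (hint : ∀ n : ℕ, Integrable (fun ω => X ω ^ n) P) (c : ℝ) :
    ∫⁻ ω, ENNReal.ofReal (Real.cosh (c * X ω)) ∂P =
      ∑' n : ℕ, ENNReal.ofReal (c ^ (2 * n) / (2 * n).factorial * ∫ ω, X ω ^ (2 * n) ∂P) := by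
  have hnn : ∀ (n : ℕ) (ω : Ω), 0 ≤ (c * X ω) ^ (2 * n) / (2 * n).factorial := fun n ω =>
    div_nonneg ((even_two_mul n).pow_nonneg _) (by positivity)
  have : ∀ ω, ENNReal.ofReal (Real.cosh (c * X ω)) =
      ∑' n : ℕ, ENNReal.ofReal ((c * X ω) ^ (2 * n) / (2 * n).factorial) := fun ω => by
    rw [← (Real.hasSum_cosh (c * X ω)).tsum_eq,
      ENNReal.ofReal_tsum_of_nonneg (fun n => hnn n ω) (Real.hasSum_cosh _).summable]
  simp only [this]
  rw [lintegral_tsum fun n => by fun_prop]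
  congr with n
  have e : ∀ ω, (c * X ω) ^ (2 * n) / (2 * n).factorial =
      c ^ (2 * n) / (2 * n).factorial * X ω ^ (2 * n) := fun ω => by rw [mul_pow]; ring
  rw [← integral_const_mul]
  simp only [e]
  exact (ofReal_integral_eq_lintegral_ofReal ((hint _).const_mul _)
    (Filter.Eventually.of_forall fun ω => (hnn n ω).trans_eq (e ω))).symm

/-- Exponential moments are inherited by random variables with the same moments. -/
theorem integrable_exp_abs_of_moments {Ω Ω' : Type*} {mΩ : MeasurableSpace Ω}
    {mΩ' : MeasurableSpace Ω'} {P : Measure Ω} {P' : Measure Ω'} {X : Ω → ℝ} {Y : Ω' → ℝ}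
    (hX : Measurable X) (hY : Measurable Y)
    (hXint : ∀ n : ℕ, Integrable (fun ω => X ω ^ n) P)
    (hYint : ∀ n : ℕ, Integrable (fun ω => Y ω ^ n) P')
    (h : ∀ n : ℕ, ∫ ω, Y ω ^ n ∂P' = ∫ ω, X ω ^ n ∂P) {c : ℝ} (hc : 0 < c)
    (hexp : Integrable (fun ω => Real.exp (c * |X ω|)) P) :
    Integrable (fun ω => Real.exp (c * |Y ω|)) P' := by
  have hXc : Integrable (fun ω => Real.cosh (c * X ω)) P := by
    refine hexp.mono' (by fun_prop) (Filter.Eventually.of_forall fun ω => ?_)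
    rw [Real.norm_of_nonneg (Real.cosh_pos _).le, ← Real.cosh_abs, abs_mul, abs_of_pos hc,
      Real.cosh_eq]
    have : Real.exp (-(c * |X ω|)) ≤ Real.exp (c * |X ω|) :=
      Real.exp_le_exp.2 (neg_le_self (by positivity))
    linarith
  have hYc : Integrable (fun ω => Real.cosh (c * Y ω)) P' := by
    refine ⟨by fun_prop, ?_⟩
    rw [hasFiniteIntegral_iff_ofReal (Filter.Eventually.of_forall fun ω => (Real.cosh_pos _).le),
      lintegral_cosh_eq hY hYint]
    simp only [h]
    rw [← lintegral_cosh_eq hX hXint, ← hasFiniteIntegral_iff_ofReal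
      (Filter.Eventually.of_forall fun ω => (Real.cosh_pos _).le)]
    exact hXc.2
  refine (hYc.const_mul 2).mono' (by fun_prop) (Filter.Eventually.of_forall fun ω => ?_)
  rw [Real.norm_of_nonneg (Real.exp_pos _).le, ← Real.cosh_abs (c * Y ω), abs_mul, abs_of_pos hc,
    Real.cosh_eq]
  have := Real.exp_pos (-(c * |Y ω|))
  linarith

theorem monomial_single {ι : Type*} [Fintype ι] [DecidableEq ι] (i : ι) (n : ℕ) (x : ι → ℝ) :
    monomial (Pi.single i n) x = x i ^ n := by
  rw [monomial, Finset.prod_eq_single i]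
  · simp
  · intro j _ hj; simp [hj]
  · simp

/-- A finite measure on `ℝ^ι` whose coordinates have exponential moments is determined by its
moments. -/
theorem eq_of_moments_eq {ι : Type*} [Fintype ι] {μ ν : Measure (ι → ℝ)} [IsFiniteMeasure μ]
    {c : ℝ} (hc : 0 < c) (hexp : ∀ i, Integrable (fun x => Real.exp (c * |x i|)) μ)
    (hν : ∀ α : ι → ℕ, Integrable (monomial α) ν)
    (h : ∀ α : ι → ℕ, ∫ x, monomial α x ∂ν = ∫ x, monomial α x ∂μ) : ν = μ := by
  classical
  have hμ := fun α => integrable_monomial hc hexp α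
  -- The zeroth moment of `ν` is integrable, which is finiteness of its mass.
  have : IsFiniteMeasure ν := by
    have := hν 0
    have e : (monomial 0 : (ι → ℝ) → ℝ) = fun _ => 1 := by ext x; simp [monomial]
    rw [e, integrable_const_iff] at this
    simpa using this
  have hexpν : ∀ i, Integrable (fun x => Real.exp (c * |x i|)) ν := fun i => by
    refine integrable_exp_abs_of_moments (P := μ) (X := fun x => x i) (measurable_pi_apply i)
      (measurable_pi_apply i) (fun n => ?_) (fun n => ?_) (fun n => ?_) hc (hexp i)
    · exact (hμ (Pi.single i n)).congr (Filter.Eventually.of_forall (monomial_single i n))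
    · exact (hν (Pi.single i n)).congr (Filter.Eventually.of_forall (monomial_single i n))
    · simpa only [monomial_single] using h (Pi.single i n)
  -- The complex mgf of `L` at `I` is the characteristic function at `L`.
  refine Measure.ext_of_charFunDual (funext fun L => ?_)
  have := complexMGF_I_eq_of_moments (zero_mem_interior_integrableExpSet hc hexpν L)
    (zero_mem_interior_integrableExpSet hc hexp L) (integral_strongDual_pow_eq hμ hν h L)
  simpa only [complexMGF, charFunDual_apply, mul_comm] using this

/-- Moments in the coordinates `c` are moments of the image measure on `ι → ℝ`, and a measurable
embedding lets a measure be recovered from its image. -/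
theorem isMomentDeterminate_of_exp {E ι : Type*} [MeasurableSpace E] [Fintype ι] {c : E → ι → ℝ}
    (hcoord : MeasurableEmbedding c) {μ : Measure E} [IsFiniteMeasure μ] {t : ℝ} (ht : 0 < t)
    (hexp : ∀ i, Integrable (fun x => Real.exp (t * |c x i|)) μ) : IsMomentDeterminate c μ := by
  have hexp' : ∀ i, Integrable (fun x => Real.exp (t * |x i|)) (μ.map c) := fun i =>
    hcoord.integrable_map_iff.2 (hexp i)
  refine ⟨fun α => hcoord.integrable_map_iff.1 (integrable_monomial ht hexp' α), fun ν hν => ?_⟩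
  have : ν.map c = μ.map c := by
    refine eq_of_moments_eq ht hexp' (fun α => hcoord.integrable_map_iff.2 (hν α).1) fun α => ?_
    rw [hcoord.integral_map, hcoord.integral_map]
    exact (hν α).2
  rw [← hcoord.comap_map ν, this, hcoord.comap_map]

/-! ### Gaussian mixtures -/

instance isProbabilityMeasure_gaussian {d : ℕ} (θ : Param d) : IsProbabilityMeasure (gaussian θ) := by
  unfold gaussian; infer_instance

open scoped MatrixOrder Matrix.Norms.L2Operator in
/-- The Gaussian measure depends weakly continuously on its parameters where `Σ` is positive
semidefinite. -/
theorem continuous_integral_gaussian {d : ℕ} {S : Set (Param d)}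
    (h : ∀ θ ∈ S, θ.cov.PosSemidef) (f : BoundedContinuousFunction (Space d) ℝ) :
    Continuous fun θ : S => ∫ x, f x ∂(gaussian (θ : Param d)) := by
  have hs : Continuous fun θ : S => CFC.sqrt (θ : Param d).cov := by
    have hc : Continuous fun θ : S => (θ : Param d).cov :=
      continuous_matrix fun i j =>
        (continuous_apply (Sum.inr s(i, j) : ParamIndex d)).comp continuous_subtype_val
    exact CFC.continuousOn_sqrt.comp_continuous hc fun θ => (h θ θ.2).nonneg
  have hm : Continuous fun θ : S => (θ : Param d).mean :=
    (PiLp.continuous_toLp 2 _).comp (continuous_pi fun i =>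
      (continuous_apply (Sum.inl i : ParamIndex d)).comp continuous_subtype_val)
  have hj : ∀ x : Space d, Continuous fun θ : S => (θ : Param d).mean +
      Matrix.toEuclideanCLM (𝕜 := ℝ) (n := Fin d) (CFC.sqrt (θ : Param d).cov) x := fun x => by
    refine hm.add ?_
    have : Continuous fun θ : S =>
        (WithLp.toLp 2 ((CFC.sqrt (θ : Param d).cov).mulVec x.ofLp) : Space d) :=
      (PiLp.continuous_toLp 2 _).comp (Continuous.matrix_mulVec hs continuous_const)
    exact this
  -- Integrating against the fixed standard Gaussian moves the parameter into the integrand, where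
  -- dominated convergence applies with bound `‖f‖`.
  have e : ∀ θ : S, ∫ x, f x ∂(gaussian (θ : Param d)) = ∫ x, f ((θ : Param d).mean +
      Matrix.toEuclideanCLM (𝕜 := ℝ) (n := Fin d) (CFC.sqrt (θ : Param d).cov) x)
        ∂(stdGaussian (Space d)) := fun θ => by
    rw [gaussian, multivariateGaussian, integral_map (by fun_prop)
      f.continuous.aestronglyMeasurable]
  simp only [e]
  refine continuous_of_dominated (bound := fun _ => ‖f‖) (fun θ => ?_)
    (fun θ => Filter.Eventually.of_forall fun x => f.norm_coe_le_norm _) (integrable_const _)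
    (Filter.Eventually.of_forall fun x => f.continuous.comp (hj x))
  exact (f.continuous.measurable.comp (by fun_prop)).aestronglyMeasurable

/-- The Gaussian measures with parameters in `S`, as a Markov kernel. -/
def gaussianKernel {d : ℕ} {S : Set (Param d)} (h : ∀ θ ∈ S, θ.cov.PosSemidef) :
    Kernel S (Space d) :=
  ⟨fun θ => gaussian (θ : Param d), measurable_gaussian h⟩

instance isMarkovKernel_gaussianKernel {d : ℕ} {S : Set (Param d)}
    (h : ∀ θ ∈ S, θ.cov.PosSemidef) : IsMarkovKernel (gaussianKernel h) :=
  ⟨fun θ => isProbabilityMeasure_gaussian (θ : Param d)⟩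

theorem mixture_eq_comp {d : ℕ} {S : Set (Param d)} (h : ∀ θ ∈ S, θ.cov.PosSemidef)
    (φ : ProbabilityMeasure S) : mixture φ = gaussianKernel h ∘ₘ (φ : Measure S) := rfl

theorem isProbabilityMeasure_mixture {d : ℕ} {S : Set (Param d)}
    (h : ∀ θ ∈ S, θ.cov.PosSemidef) (φ : ProbabilityMeasure S) :
    IsProbabilityMeasure (mixture φ) := by
  rw [mixture_eq_comp h]; infer_instance

theorem integral_mixture {d : ℕ} {S : Set (Param d)} (h : ∀ θ ∈ S, θ.cov.PosSemidef)
    (φ : ProbabilityMeasure S) {f : Space d → ℝ} (hf : Integrable f (mixture φ)) :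
    ∫ x, f x ∂(mixture φ) = ∫ θ : S, ∫ x, f x ∂(gaussian (θ : Param d)) ∂(φ : Measure S) := by
  rw [mixture_eq_comp h, Measure.comp_eq_comp_const_apply] at hf ⊢
  exact Kernel.integral_comp hf

/-- The mixture as a probability measure. -/
def mixtureProb {d : ℕ} {S : Set (Param d)} (h : ∀ θ ∈ S, θ.cov.PosSemidef)
    (φ : ProbabilityMeasure S) : ProbabilityMeasure (Space d) :=
  ⟨mixture φ, isProbabilityMeasure_mixture h φ⟩

/-- The Gaussian mixture depends weakly continuously on the mixing measure. -/
theorem continuous_mixtureProb {d : ℕ} {S : Set (Param d)} (h : ∀ θ ∈ S, θ.cov.PosSemidef) :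
    Continuous (mixtureProb h) := by
  refine ProbabilityMeasure.continuous_iff_forall_continuous_integral.2 fun f => ?_
  let F : BoundedContinuousFunction S ℝ :=
    BoundedContinuousFunction.ofNormedAddCommGroup _ (continuous_integral_gaussian h f) ‖f‖
      fun θ => by
        simpa using norm_integral_le_of_norm_le_const (μ := gaussian (θ : Param d))
          (Filter.Eventually.of_forall f.norm_coe_le_norm)
  have e : ∀ φ : ProbabilityMeasure S,
      ∫ x, f x ∂(mixtureProb h φ : Measure (Space d)) = ∫ θ, F θ ∂(φ : Measure S) := fun φ =>
    integral_mixture h φ (f.integrable (mixtureProb h φ : Measure (Space d)))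
  simp only [e]
  exact ProbabilityMeasure.continuous_iff_forall_continuous_integral.1 continuous_id F

/-- The `i`-th marginal is a real Gaussian with mean `m i` and variance `Σ i i`; bound `exp |y|` by
`exp y + exp (-y)` and use its mgf at `±1`. The bound is continuous in the parameters, hence bounded
on compact sets. -/
theorem lintegral_exp_abs_gaussian_le {d : ℕ} {θ : Param d} (h : θ.cov.PosSemidef) (i : Fin d) :
    ∫⁻ x, ENNReal.ofReal (Real.exp |x i|) ∂(gaussian θ) ≤
      ENNReal.ofReal (2 * Real.exp (|θ (Sum.inl i)| + |θ (Sum.inr s(i, i))| / 2)) := by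
  set m := θ (Sum.inl i)
  set v := θ (Sum.inr s(i, i))
  have hmap : ∫⁻ x, ENNReal.ofReal (Real.exp |x i|) ∂(gaussian θ) =
      ∫⁻ y, ENNReal.ofReal (Real.exp |y|) ∂(gaussianReal m v.toNNReal) :=
    (measurePreserving_eval_multivariateGaussian (μ := θ.mean) h (i := i)).lintegral_comp
      (f := fun y => ENNReal.ofReal (Real.exp |y|)) (by fun_prop)
  have hint : ∀ t : ℝ, Integrable (fun y => Real.exp (t * y)) (gaussianReal m v.toNNReal) :=
    fun t => integrable_exp_mul_gaussianReal t
  have hle : ∀ y : ℝ, Real.exp |y| ≤ Real.exp (1 * y) + Real.exp (-1 * y) := fun y => by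
    rcases abs_cases y with ⟨hy, -⟩ | ⟨hy, -⟩ <;> rw [hy] <;>
      simp [Real.exp_nonneg]
  rw [hmap]
  refine (lintegral_mono fun y => ENNReal.ofReal_le_ofReal (hle y)).trans ?_
  rw [← ofReal_integral_eq_lintegral_ofReal
    (f := fun y => Real.exp (1 * y) + Real.exp (-1 * y)) ((hint 1).add (hint (-1))) (Filter.Eventually.of_forall fun y => by positivity), integral_add (hint 1) (hint (-1))]
  refine ENNReal.ofReal_le_ofReal ?_
  have hmgf : ∀ t : ℝ, ∫ y, Real.exp (t * y) ∂(gaussianReal m v.toNNReal) =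
      Real.exp (m * t + v.toNNReal * t ^ 2 / 2) := fun t =>
    congrFun (mgf_id_gaussianReal (μ := m) (v := v.toNNReal)) t
  rw [hmgf, hmgf, two_mul]
  have hv : (v.toNNReal : ℝ) ≤ |v| := by
    rw [Real.coe_toNNReal']; exact max_le (le_abs_self v) (abs_nonneg v)
  have := le_abs_self m
  have := neg_abs_le m
  gcongr <;> linarith

theorem integrable_exp_abs_mixture {d : ℕ} {S : Set (Param d)} (h : ∀ θ ∈ S, θ.cov.PosSemidef)
    (hS : IsCompact S) (φ : ProbabilityMeasure S) (i : Fin d) :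
    Integrable (fun x => Real.exp |x i|) (mixture φ) := by
  have hcont : Continuous fun θ : Param d =>
      2 * Real.exp (|θ (Sum.inl i)| + |θ (Sum.inr s(i, i))| / 2) := by fun_prop
  obtain ⟨K, hK⟩ := hS.bddAbove_image hcont.continuousOn
  refine ⟨by fun_prop, ?_⟩
  rw [hasFiniteIntegral_iff_ofReal (Filter.Eventually.of_forall fun x => (Real.exp_pos _).le),
    mixture, Measure.lintegral_bind (measurable_gaussian h).aemeasurable (by fun_prop)]
  calc _ ≤ ∫⁻ _ : S, ENNReal.ofReal K ∂(φ : Measure S) :=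
        lintegral_mono fun θ => (lintegral_exp_abs_gaussian_le (h θ θ.2) i).trans
          (ENNReal.ofReal_le_ofReal (hK ⟨θ, θ.2, rfl⟩))
    _ < ⊤ := by simp

/-! ### Coordinates and determinacy of the measures of the problem -/

theorem measurableEmbedding_coord (d : ℕ) :
    MeasurableEmbedding fun (x : Space d) (i : Fin d) => x i :=
  (MeasurableEquiv.toLp 2 (Fin d → ℝ)).symm.measurableEmbedding

theorem measurableEmbedding_pairCoord (d : ℕ) :
    MeasurableEmbedding (pairCoord : Space d × Space d → Fin d ⊕ Fin d → ℝ) := by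
  have h := ((MeasurableEquiv.prodCongr (MeasurableEquiv.toLp 2 (Fin d → ℝ)).symm
    (MeasurableEquiv.toLp 2 (Fin d → ℝ)).symm).trans
    (MeasurableEquiv.sumPiEquivProdPi fun _ : Fin d ⊕ Fin d => ℝ).symm).measurableEmbedding
  convert h using 1
  funext z k
  cases k <;> rfl

theorem integrable_exp_abs_mono {Ω : Type*} {mΩ : MeasurableSpace Ω} {P : Measure Ω} {X : Ω → ℝ}
    {s t : ℝ} (hst : s ≤ t) (hX : Measurable X)
    (h : Integrable (fun ω => Real.exp (t * |X ω|)) P) :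
    Integrable (fun ω => Real.exp (s * |X ω|)) P := by
  refine h.mono' (by fun_prop) (Filter.Eventually.of_forall fun ω => ?_)
  rw [Real.norm_of_nonneg (Real.exp_pos _).le]
  gcongr

theorem isMomentDeterminate_mixture {d : ℕ} {S : Set (Param d)}
    (h : ∀ θ ∈ S, θ.cov.PosSemidef) (hS : IsCompact S) (φ : ProbabilityMeasure S) :
    IsMomentDeterminate (fun (x : Space d) (i : Fin d) => x i) (mixture φ) := by
  have := isProbabilityMeasure_mixture h φ
  exact isMomentDeterminate_of_exp (measurableEmbedding_coord d) one_pos fun i => by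
    simpa only [one_mul] using integrable_exp_abs_mixture h hS φ i

/-- Couplings of measures with exponential moments are moment determinate. -/
theorem isMomentDeterminate_coupling {d : ℕ} {lam : Measure (Space d × Space d)}
    [IsFiniteMeasure lam] {s t : ℝ} (hs : 0 < s) (ht : 0 < t)
    (h₁ : ∀ i, Integrable (fun x : Space d => Real.exp (s * |x i|)) (lam.map Prod.fst))
    (h₂ : ∀ i, Integrable (fun y : Space d => Real.exp (t * |y i|)) (lam.map Prod.snd)) :
    IsMomentDeterminate pairCoord lam := by
  refine isMomentDeterminate_of_exp (measurableEmbedding_pairCoord d) (lt_min hs ht) ?_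
  rintro (i | i)
  · exact (integrable_exp_abs_mono (min_le_left s t) (by fun_prop) (h₁ i)).comp_measurable
      measurable_fst
  · exact (integrable_exp_abs_mono (min_le_right s t) (by fun_prop) (h₂ i)).comp_measurable
      measurable_snd

/-- The moment constraints amount to the marginal constraints, because `μ` and the mixtures are
moment determinate. -/
theorem momentFeasible_eq_transportFeasible {d : ℕ} {S : Set (Param d)}
    (h : ∀ θ ∈ S, θ.cov.PosSemidef) (hS : IsCompact S) {μ : Measure (Space d)}
    (hμ : IsMomentDeterminate (fun (x : Space d) (i : Fin d) => x i) μ) :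
    momentFeasible μ S = transportFeasible μ S := by
  have hmeas : ∀ α : Fin d → ℕ, Measurable fun x : Space d => monomial α x := fun α =>
    (measurable_monomial α).comp (measurableEmbedding_coord d).measurable
  ext ⟨φ, lam⟩
  have hν := isMomentDeterminate_mixture h hS φ
  have hmom : ∀ α : Fin d → ℕ, ∫ θ, gaussianMoment α (θ : Param d) ∂(φ : Measure S) =
      ∫ x, monomial α x ∂(mixture φ) := fun α => (integral_mixture h φ (hν.1 α)).symm
  constructor
  · intro hm
    refine ⟨hμ.2 _ fun α => ?_, hν.2 _ fun α => ?_⟩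
    · obtain ⟨⟨h1, h2⟩, -⟩ := hm α
      refine ⟨(integrable_map_measure (hmeas α).aestronglyMeasurable measurable_fst.aemeasurable).2
        h1, ?_⟩
      rw [integral_map measurable_fst.aemeasurable (hmeas α).aestronglyMeasurable]
      exact h2
    · obtain ⟨-, h1, h2⟩ := hm α
      refine ⟨(integrable_map_measure (hmeas α).aestronglyMeasurable measurable_snd.aemeasurable).2
        h1, ?_⟩
      rw [integral_map measurable_snd.aemeasurable (hmeas α).aestronglyMeasurable]
      exact h2.trans (hmom α)
  · rintro ⟨h1, h2⟩ α
    dsimp only at h1 h2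
    have i1 := hμ.1 α
    have i2 := hν.1 α
    rw [hmom α]
    constructor
    · rw [← h1] at i1 ⊢
      rw [integral_map measurable_fst.aemeasurable (hmeas α).aestronglyMeasurable]
      exact ⟨i1.comp_measurable measurable_fst, rfl⟩
    · rw [← h2] at i2 ⊢
      rw [integral_map measurable_snd.aemeasurable (hmeas α).aestronglyMeasurable]
      exact ⟨i2.comp_measurable measurable_snd, rfl⟩

/-! ### Existence of optimal couplings -/

/-- Couplings of measures from two tight families form a tight family. -/
theorem isTightMeasureSet_coupling {X Y : Type*} [TopologicalSpace X] [TopologicalSpace Y]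
    [MeasurableSpace X] [MeasurableSpace Y] [OpensMeasurableSpace X] [OpensMeasurableSpace Y]
    [T2Space X] [T2Space Y] {A : Set (Measure X)} {B : Set (Measure Y)}
    (hA : IsTightMeasureSet A) (hB : IsTightMeasureSet B) :
    IsTightMeasureSet {lam : Measure (X × Y) | lam.map Prod.fst ∈ A ∧ lam.map Prod.snd ∈ B} := by
  rw [isTightMeasureSet_iff_exists_isCompact_measure_compl_le] at *
  intro ε hε
  have hε' : 0 < ε / 2 := ENNReal.half_pos hε.ne'
  obtain ⟨K, hK, hKA⟩ := hA _ hε'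
  obtain ⟨L, hL, hLB⟩ := hB _ hε'
  refine ⟨K ×ˢ L, hK.prod hL, fun lam ⟨h1, h2⟩ => ?_⟩
  have e1 := hKA _ h1
  have e2 := hLB _ h2
  rw [Measure.map_apply measurable_fst hK.measurableSet.compl] at e1
  rw [Measure.map_apply measurable_snd hL.measurableSet.compl] at e2
  calc lam (K ×ˢ L)ᶜ ≤ lam (Prod.fst ⁻¹' Kᶜ ∪ Prod.snd ⁻¹' Lᶜ) := by
        refine measure_mono fun z hz => ?_
        rw [Set.mem_compl_iff, Set.mem_prod, not_and_or] at hz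
        exact hz
    _ ≤ ε / 2 + ε / 2 := (measure_union_le _ _).trans (add_le_add e1 e2)
    _ = ε := ENNReal.add_halves ε

/-- The integral of a nonnegative continuous function is weakly lower semicontinuous. -/
theorem lowerSemicontinuous_lintegral {X : Type*} [TopologicalSpace X] [MeasurableSpace X]
    [OpensMeasurableSpace X] {f : X → NNReal} (hf : Continuous f) :
    LowerSemicontinuous fun P : ProbabilityMeasure X => ∫⁻ x, f x ∂(P : Measure X) := by
  -- The truncations `min f n` are bounded and continuous, so their integrals are weakly continuous;
  -- by monotone convergence the integral of `f` is their supremum.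
  let F : ℕ → BoundedContinuousFunction X NNReal := fun n =>
    BoundedContinuousFunction.mkOfBound ⟨fun x => min (f x) n, hf.min continuous_const⟩ n
      fun x y => by
        rw [NNReal.dist_eq, abs_sub_le_iff]
        have h1 : ((min (f x) n : NNReal) : ℝ) ≤ n := by exact_mod_cast min_le_right (f x) n
        have h2 : ((min (f y) n : NNReal) : ℝ) ≤ n := by exact_mod_cast min_le_right (f y) n
        have h3 := (min (f x) n).coe_nonneg
        have h4 := (min (f y) n).coe_nonneg
        constructor <;> simp only [ContinuousMap.coe_mk] <;> linarith
  have e : ∀ P : ProbabilityMeasure X, ∫⁻ x, f x ∂(P : Measure X) =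
      ⨆ n, ∫⁻ x, F n x ∂(P : Measure X) := fun P => by
    rw [← lintegral_iSup (fun n => (F n).continuous.measurable.coe_nnreal_ennreal)]
    · refine lintegral_congr fun x => le_antisymm ?_ (iSup_le fun n => ?_)
      · obtain ⟨n, hn⟩ := exists_nat_ge (f x)
        refine le_iSup_of_le n (ENNReal.coe_le_coe.2 ?_)
        exact le_min le_rfl hn
      · exact ENNReal.coe_le_coe.2 (min_le_left _ _)
    · intro m n hmn x
      exact ENNReal.coe_le_coe.2 (min_le_min le_rfl (by exact_mod_cast hmn))
  simp only [e]
  exact lowerSemicontinuous_iSup fun n =>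
    (ProbabilityMeasure.continuous_lintegral_boundedContinuousFunction (F n)).lowerSemicontinuous

theorem lowerSemicontinuous_cost (d : ℕ) :
    LowerSemicontinuous fun P : ProbabilityMeasure (Space d × Space d) =>
      cost (P : Measure (Space d × Space d)) :=
  lowerSemicontinuous_lintegral (f := fun z : Space d × Space d => ‖z.1 - z.2‖₊ ^ 2) (by fun_prop)

/-- Prokhorov's theorem is used in both directions: the mixtures form a compact, hence tight,
family, so the couplings of `μ` with them are tight and therefore relatively compact. -/
theorem isCompact_transportFeasible {d : ℕ} {S : Set (Param d)} (h : ∀ θ ∈ S, θ.cov.PosSemidef)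
    (hS : IsCompact S) (μ : Measure (Space d)) [IsProbabilityMeasure μ] :
    IsCompact (transportFeasible μ S) := by
  have : CompactSpace S := isCompact_iff_compactSpace.1 hS
  let M : ProbabilityMeasure (Space d) := ⟨μ, inferInstance⟩
  have hrange : IsCompact (Set.range (mixtureProb h)) :=
    isCompact_range (continuous_mixtureProb h)
  have htight := isTightMeasureSet_coupling (isTightMeasureSet_singleton (μ := μ))
    (isTightMeasureSet_of_isCompact_closure (hrange.isClosed.closure_eq.symm ▸ hrange))
  set T : Set (ProbabilityMeasure (Space d × Space d)) :=
    {lam | (lam : Measure (Space d × Space d)).map Prod.fst ∈ ({μ} : Set (Measure (Space d))) ∧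
      (lam : Measure (Space d × Space d)).map Prod.snd ∈
        {((ν : ProbabilityMeasure (Space d)) : Measure (Space d)) |
          ν ∈ Set.range (mixtureProb h)}}
  have hTc : IsCompact (closure T) := isCompact_closure_of_isTightMeasureSet
    (htight.subset (by rintro _ ⟨lam, hlam, rfl⟩; exact hlam))
  -- Each marginal constraint equates two weakly continuous functions of the pair `(φ, λ)`.
  have hclosed : IsClosed (transportFeasible μ S) := by
    have e : transportFeasible μ S =
        {p | p.2.map measurable_fst.aemeasurable = M} ∩
          {p | p.2.map measurable_snd.aemeasurable = mixtureProb h p.1} := by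
      ext p
      exact and_congr (Subtype.ext_iff (p := fun ν : Measure (Space d) => IsProbabilityMeasure ν)
        (a1 := p.2.map measurable_fst.aemeasurable) (a2 := M)).symm
        (Subtype.ext_iff (a1 := p.2.map measurable_snd.aemeasurable)
          (a2 := mixtureProb h p.1)).symm
    rw [e]
    exact (isClosed_eq ((ProbabilityMeasure.continuous_map continuous_fst).comp continuous_snd)
      continuous_const).inter
      (isClosed_eq ((ProbabilityMeasure.continuous_map continuous_snd).comp continuous_snd)
        ((continuous_mixtureProb h).comp continuous_fst))
  refine (isCompact_univ.prod hTc).of_isClosed_subset hclosed fun p hp =>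
    ⟨Set.mem_univ _, subset_closure ⟨hp.1, mixtureProb h p.1, ⟨p.1, rfl⟩, hp.2.symm⟩⟩

theorem exists_isOptimal_transport {d : ℕ} {S : Set (Param d)}
    (h : ∀ θ ∈ S, θ.cov.PosSemidef) (hS : IsCompact S) (hne : S.Nonempty) (μ : Measure (Space d))
    [IsProbabilityMeasure μ] : ∃ p, IsOptimal (transportFeasible μ S) p := by
  obtain ⟨θ, hθ⟩ := hne
  -- A Dirac mass in `S` and the product coupling give a feasible pair.
  let φ : ProbabilityMeasure S := ⟨Measure.dirac ⟨θ, hθ⟩, inferInstance⟩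
  have := isProbabilityMeasure_mixture h φ
  have hfeas : (transportFeasible μ S).Nonempty := by
    refine ⟨(φ, ⟨μ.prod (mixture φ), inferInstance⟩), ?_, ?_⟩
    · simp
    · simp
  obtain ⟨p, hp, hmin⟩ := LowerSemicontinuousOn.exists_isMinOn hfeas
    (isCompact_transportFeasible h hS μ)
    (((lowerSemicontinuous_cost d).comp continuous_snd).lowerSemicontinuousOn _)
  exact ⟨p, hp, fun q hq => hmin hq⟩

/-! ### The optimal value -/

theorem IsOptimal.wassersteinSq_eq {d : ℕ} {S : Set (Param d)} {μ : Measure (Space d)}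
    {p : ProbabilityMeasure S × ProbabilityMeasure (Space d × Space d)}
    (hp : IsOptimal (transportFeasible μ S) p) :
    wassersteinSq μ (mixture p.1) = cost (p.2 : Measure (Space d × Space d)) :=
  le_antisymm (iInf₂_le p.2 hp.1) (le_iInf₂ fun lam hlam => hp.2 (p.1, lam) hlam)

theorem IsOptimal.optValue_eq {d : ℕ} {S : Set (Param d)} {μ : Measure (Space d)}
    {p : ProbabilityMeasure S × ProbabilityMeasure (Space d × Space d)}
    (hp : IsOptimal (transportFeasible μ S) p) :
    optValue μ S = cost (p.2 : Measure (Space d × Space d)) :=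
  le_antisymm ((iInf_le _ p.1).trans hp.wassersteinSq_eq.le)
    (le_iInf fun φ => le_iInf₂ fun lam hlam => hp.2 (φ, lam) hlam)

theorem cost_map_diag {d : ℕ} (μ : Measure (Space d)) : cost (μ.map fun x => (x, x)) = 0 := by
  rw [cost, lintegral_map (by fun_prop) (by fun_prop)]
  simp

/-- A coupling of zero cost is the diagonal coupling of its first marginal. -/
theorem eq_map_diag_of_cost_eq_zero {d : ℕ} {lam : Measure (Space d × Space d)}
    (h : cost lam = 0) : lam = (lam.map Prod.fst).map fun x => (x, x) := by
  rw [cost, lintegral_eq_zero_iff (by fun_prop)] at h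
  rw [Measure.map_map (by fun_prop) measurable_fst]
  conv_lhs => rw [← Measure.map_id (μ := lam)]
  -- Zero cost gives `z.1 = z.2` almost everywhere, so the identity and `z ↦ (z.1, z.1)` have the
  -- same image measure.
  refine Measure.map_congr ?_
  filter_upwards [h] with z hz
  have hz' : z.1 = z.2 := by simpa [sub_eq_zero] using hz
  exact Prod.ext rfl hz'.symm

theorem IsOptimal.optValue_eq_zero_iff {d : ℕ} {S : Set (Param d)} {μ : Measure (Space d)}
    {p : ProbabilityMeasure S × ProbabilityMeasure (Space d × Space d)}
    (hp : IsOptimal (transportFeasible μ S) p) :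
    optValue μ S = 0 ↔
      (p.2 : Measure (Space d × Space d)) = μ.map (fun x => (x, x)) ∧ μ = mixture p.1 := by
  rw [hp.optValue_eq]
  refine ⟨fun h => ?_, fun h => by rw [h.1, cost_map_diag]⟩
  have e := eq_map_diag_of_cost_eq_zero h
  rw [hp.1.1] at e
  refine ⟨e, ?_⟩
  have h2 := hp.1.2
  rw [e, Measure.map_map measurable_snd (by fun_prop)] at h2
  rw [← h2]
  exact Measure.map_id.symm

theorem optValue_eq_zero_of_eq_mixture {d : ℕ} {S : Set (Param d)} {μ : Measure (Space d)}
    [IsProbabilityMeasure μ] {φ : ProbabilityMeasure S} (h : μ = mixture φ) :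
    optValue μ S = 0 := by
  refine le_antisymm ?_ zero_le
  have hdiag : IsProbabilityMeasure (μ.map fun x => (x, x)) :=
    Measure.isProbabilityMeasure_map (by fun_prop)
  rw [← cost_map_diag μ]
  let lam : ProbabilityMeasure (Space d × Space d) := ⟨μ.map fun x => (x, x), hdiag⟩
  refine (iInf_le _ φ).trans (iInf₂_le lam ⟨?_, ?_⟩)
  · exact (Measure.map_map measurable_fst (by fun_prop)).trans Measure.map_id
  · exact (Measure.map_map measurable_snd (by fun_prop)).trans (Measure.map_id.trans h)

end GaussianMixtureOT

end

theorem theorem4p2 (d s : ℕ)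
    (g : Fin s → MvPolynomial (GaussianMixtureOT.ParamIndex d) ℝ)
    (S : Set (GaussianMixtureOT.Param d))
    (hS : S = GaussianMixtureOT.semialgebraicSet g)
    (hcov : ∀ θ ∈ S, θ.cov.PosSemidef)
    (hcompact : IsCompact S)
    (hinterior : (interior S).Nonempty)
    (harch : GaussianMixtureOT.IsArchimedean g)
    (μ : Measure (GaussianMixtureOT.Space d)) [IsProbabilityMeasure μ]
    (hμ : ∃ c : ℝ, 0 < c ∧ ∀ i : Fin d, Integrable (fun x => Real.exp (c * |x i|)) μ) :
    -- existence of an optimal solution, common to both problems, with determinate measures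
    (∃ (φ : ProbabilityMeasure S)
        (lam : ProbabilityMeasure (GaussianMixtureOT.Space d × GaussianMixtureOT.Space d)),
      GaussianMixtureOT.IsOptimal (GaussianMixtureOT.transportFeasible μ S) (φ, lam) ∧
      GaussianMixtureOT.IsOptimal (GaussianMixtureOT.momentFeasible μ S) (φ, lam) ∧
      GaussianMixtureOT.optValue μ S =
        GaussianMixtureOT.wassersteinSq μ (GaussianMixtureOT.mixture φ) ∧
      GaussianMixtureOT.optValue μ S = GaussianMixtureOT.cost
        (lam : Measure (GaussianMixtureOT.Space d × GaussianMixtureOT.Space d)) ∧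
      GaussianMixtureOT.IsMomentDeterminate GaussianMixtureOT.pairCoord
        (lam : Measure (GaussianMixtureOT.Space d × GaussianMixtureOT.Space d)) ∧
      GaussianMixtureOT.IsMomentDeterminate
        (fun (x : GaussianMixtureOT.Space d) (i : Fin d) => x i)
        (GaussianMixtureOT.mixture φ)) ∧
    -- characterization of `τ = 0` by any optimal solution
    (∀ (φ : ProbabilityMeasure S)
        (lam : ProbabilityMeasure (GaussianMixtureOT.Space d × GaussianMixtureOT.Space d)),
      GaussianMixtureOT.IsOptimal (GaussianMixtureOT.transportFeasible μ S) (φ, lam) →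
      (GaussianMixtureOT.optValue μ S = 0 ↔
        (lam : Measure (GaussianMixtureOT.Space d × GaussianMixtureOT.Space d)) =
          μ.map (fun x => (x, x)) ∧
        μ = GaussianMixtureOT.mixture φ)) ∧
    -- `τ = 0` exactly for the Gaussian mixtures with parameters in `S`
    (GaussianMixtureOT.optValue μ S = 0 ↔
      ∃ φ : ProbabilityMeasure S, μ = GaussianMixtureOT.mixture φ) := by
  obtain ⟨c, hc, hexp⟩ := hμ
  have hdet := GaussianMixtureOT.isMomentDeterminate_of_exp
    (GaussianMixtureOT.measurableEmbedding_coord d) hc hexp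
  obtain ⟨⟨φ, lam⟩, hopt⟩ := GaussianMixtureOT.exists_isOptimal_transport hcov hcompact
    (hinterior.mono interior_subset) μ
  refine ⟨⟨φ, lam, hopt, ?_, hopt.optValue_eq.trans hopt.wassersteinSq_eq.symm, hopt.optValue_eq,
    ?_, GaussianMixtureOT.isMomentDeterminate_mixture hcov hcompact φ⟩,
    fun φ' lam' hopt' => hopt'.optValue_eq_zero_iff,
    fun h0 => ⟨φ, (hopt.optValue_eq_zero_iff.1 h0).2⟩,
    fun ⟨φ', h⟩ => GaussianMixtureOT.optValue_eq_zero_of_eq_mixture h⟩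
  · rwa [GaussianMixtureOT.momentFeasible_eq_transportFeasible hcov hcompact hdet]
  · refine GaussianMixtureOT.isMomentDeterminate_coupling hc one_pos (fun i => ?_) fun i => ?_
    · rw [hopt.1.1]; exact hexp i
    · rw [hopt.1.2]
      simpa only [one_mul] using
        GaussianMixtureOT.integrable_exp_abs_mixture hcov hcompact φ i
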